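/- Let $m,n\ge 0$ be integers and let $T:(\mathbb{R}^n)^m\to\mathbb{R}$ be a multilinear form (an order $m$ tensor in dimension $n$). The Kronecker tensor is the bilinear form $\delta(u,v)=\langle u,v\rangle=\sum_{i=1}^n u_iv_i$ (components $\delta_{ij}$), and the Levi-Civita tensor is the $n$-linear form $\epsilon(v_1,\dots,v_n)=\det[v_1\,\cdots\,v_n]$ (components $\epsilon_{i_1\dots i_n}=\operatorname{sgn}(i_1\dots i_n)$ if $(i_1,\dots,i_n)$ is a permutation of $(1,\dots,n)$, and $0$ otherwise). (1) If $T(Qu_1,\dots,Qu_m)=T(u_1,\dots,u_m)$ for all $Q\in SO(n)$ and all $u_1,\dots,u_m\in\mathbb{R}^n$, then $T$ is a real linear combination of products of Kronecker tensors and at most one Levi-Civita tensor acting on disjoint sets of indices, that is, of forms of the two types $$(u_1,\dots,u_m)\mapsto\prod_{j=1}^{k}\delta(u_{a_j},u_{b_j}),\qquad (u_1,\dots,u_m)\mapsto\prod_{j=1}^{k}\delta(u_{a_j},u_{b_j})\cdot\epsilon(u_{c_1},\dots,u_{c_n}),$$ where $k\ge 0$ and $a_1,b_1,\dots,a_k,b_k$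 (respectively $a_1,b_1,\dots,a_k,b_k,c_1,\dots,c_n$) is an enumeration of $\{1,\dots,m\}$ in which every index occurs exactly once. (2) If $T(Qu_1,\dots,Qu_m)=T(u_1,\dots,u_m)$ for all $Q\in O(n)$ and all $u_1,\dots,u_m\in\mathbb{R}^n$, then $T$ is a real linear combination of forms of the first type only, that is, of products of Kronecker tensors. Here an empty linear combination is $0$, and an empty product and the determinant of the $0\times 0$ matrix are $1$. -/

import Mathlib

open scoped Matrix

namespace IsotropicTensor

/-- Order `ι` tensors in dimension `n`: real multilinear forms on `ℝⁿ` with slots indexed by `ι`.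
An order `m` tensor is the case `ι = Fin m`. -/
abbrev Tensor (ι : Type) (n : ℕ) : Type :=
  MultilinearMap ℝ (fun _ : ι => Fin n → ℝ) ℝ

/-- `T` is invariant under a group `G` of real `n × n` matrices:
`T (Q u₁, …, Q uₘ) = T (u₁, …, uₘ)` for all `Q ∈ G` and all vectors `uᵢ`. -/
def IsInvariantUnder {m n : ℕ} (G : Submonoid (Matrix (Fin n) (Fin n) ℝ))
    (T : Tensor (Fin m) n) : Prop :=
  ∀ Q ∈ G, ∀ u : Fin m → Fin n → ℝ, T (fun i => Q *ᵥ u i) = T u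

/-- The order 2 Kronecker tensor `δ(u, v) = ⟨u, v⟩ = ∑ i, uᵢ vᵢ`. -/
def kroneckerDelta (n : ℕ) : Tensor (Fin 2) n where
  toFun v := v 0 ⬝ᵥ v 1
  map_update_add' v i x y := by
    rename_i inst
    obtain rfl : inst = instDecidableEqFin 2 := Subsingleton.elim _ _
    fin_cases i <;> simp
  map_update_smul' v i c x := by
    rename_i inst
    obtain rfl : inst = instDecidableEqFin 2 := Subsingleton.elim _ _
    fin_cases i <;> simp

/-- The order `n` Levi-Civita tensor `ε(v₁, …, vₙ) = det [v₁ ⋯ vₙ]`. -/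
def leviCivita (n : ℕ) : Tensor (Fin n) n :=
  (Matrix.detRowAlternating (n := Fin n) (R := ℝ)).toMultilinearMap

/-- The components of the Kronecker tensor. -/
theorem kroneckerDelta_component (n : ℕ) (i : Fin 2 → Fin n) :
    kroneckerDelta n (fun a => Pi.single (i a) 1) = if i 0 = i 1 then 1 else 0 := by
  simp [kroneckerDelta, Pi.single_apply, eq_comm]

/-- The components of the Levi-Civita tensor at an index tuple which is a permutation. -/
theorem leviCivita_component_perm (n : ℕ) (σ : Equiv.Perm (Fin n)) :
    leviCivita n (fun a => Pi.single (σ a) 1) = ((Equiv.Perm.sign σ : ℤ) : ℝ) := by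
  have h : (fun a => Pi.single (σ a) 1 : Fin n → Fin n → ℝ)
      = (1 : Matrix (Fin n) (Fin n) ℝ).submatrix σ id := by
    ext a b
    simp [Matrix.one_apply, Pi.single_apply, eq_comm]
  change Matrix.det (fun a => Pi.single (σ a) 1 : Fin n → Fin n → ℝ) = _
  rw [h, Matrix.det_permute, Matrix.det_one, mul_one]

/-- The components of the Levi-Civita tensor at all other index tuples. -/
theorem leviCivita_component_other (n : ℕ) (i : Fin n → Fin n) (hi : ¬ Function.Bijective i) :
    leviCivita n (fun a => Pi.single (i a) 1) = 0 := by
  have hinj : ¬ Function.Injective i := fun h => hi (Finite.injective_iff_bijective.mp h)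
  simp only [Function.Injective, not_forall] at hinj
  obtain ⟨a, b, hab, hne⟩ := hinj
  exact (Matrix.detRowAlternating (n := Fin n) (R := ℝ)).map_eq_zero_of_eq _
    (by simp only [hab]) hne

/-- The product of two tensors acting on disjoint sets of slots. -/
def tensorMul {ι κ : Type} [Fintype ι] [Fintype κ] {n : ℕ}
    (S : Tensor ι n) (T : Tensor κ n) : Tensor (ι ⊕ κ) n :=
  (LinearMap.mul' ℝ ℝ).compMultilinearMap (S.domCoprod T)

theorem tensorMul_apply {ι κ : Type} [Fintype ι] [Fintype κ] {n : ℕ}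
    (S : Tensor ι n) (T : Tensor κ n) (v : ι ⊕ κ → Fin n → ℝ) :
    tensorMul S T v = S (fun a => v (Sum.inl a)) * T (fun b => v (Sum.inr b)) := rfl

/-- The product of `k` Kronecker tensors, the `j`-th one acting on the slots `(j, 0)`, `(j, 1)`. -/
def kroneckerPower (k n : ℕ) : Tensor (Fin k × Fin 2) n where
  toFun v := ∏ j : Fin k, kroneckerDelta n (fun a => v (j, a))
  map_update_add' := by
    rintro inst v ⟨j, a⟩ x y
    obtain rfl : inst = instDecidableEqProd := Subsingleton.elim _ _
    have key : ∀ z : Fin n → ℝ, (∏ l : Fin k, kroneckerDelta n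
          (fun b => Function.update v (j, a) z (l, b)))
        = kroneckerDelta n (Function.update (fun b => v (j, b)) a z) *
          ∏ l ∈ Finset.univ.erase j, kroneckerDelta n (fun b => v (l, b)) := by
      intro z
      rw [← Finset.mul_prod_erase _ _ (Finset.mem_univ j)]
      congr 1
      · congr 1; ext b : 1
        simp [Function.update_apply]
      · refine Finset.prod_congr rfl fun l hl => ?_
        have := Finset.ne_of_mem_erase hl
        simp [this]
    rw [key, key, key, MultilinearMap.map_update_add, add_mul]
  map_update_smul' := by
    rintro inst v ⟨j, a⟩ c x
    obtain rfl : inst = instDecidableEqProd := Subsingleton.elim _ _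
    have key : ∀ z : Fin n → ℝ, (∏ l : Fin k, kroneckerDelta n
          (fun b => Function.update v (j, a) z (l, b)))
        = kroneckerDelta n (Function.update (fun b => v (j, b)) a z) *
          ∏ l ∈ Finset.univ.erase j, kroneckerDelta n (fun b => v (l, b)) := by
      intro z
      rw [← Finset.mul_prod_erase _ _ (Finset.mem_univ j)]
      congr 1
      · congr 1; ext b : 1
        simp [Function.update_apply]
      · refine Finset.prod_congr rfl fun l hl => ?_
        have := Finset.ne_of_mem_erase hl
        simp [this]
    rw [key, key, MultilinearMap.map_update_smul, smul_mul_assoc]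

/-- The order `m` tensors that are products of Kronecker tensors acting on disjoint pairs of
slots. The bijection `e` attaches the `2 * k` legs of `k` Kronecker tensors to the `m` slots, each
slot being used exactly once. -/
def kroneckerProducts (m n : ℕ) : Set (Tensor (Fin m) n) :=
  {T | ∃ (k : ℕ) (e : Fin k × Fin 2 ≃ Fin m), T = (kroneckerPower k n).domDomCongr e}

/-- The order `m` tensors that are products of Kronecker tensors and exactly one Levi-Civita
tensor, acting on disjoint sets of slots. -/
def kroneckerLeviCivitaProducts (m n : ℕ) : Set (Tensor (Fin m) n) :=
  {T | ∃ (k : ℕ) (e : (Fin k × Fin 2) ⊕ Fin n ≃ Fin m),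
    T = (tensorMul (kroneckerPower k n) (leviCivita n)).domDomCongr e}

end IsotropicTensor

/-!
# Isotropic tensors

The case of `O(n)` is proved by averaging over a Gaussian random matrix `X`. Two facts about the
average `A T := E [T (X v₁, …, X vₘ)]` of a tensor `T` are used.

* `A T` is a combination of products of Kronecker tensors, for every `T`. This is Wick's theorem
  (`integral_mixedArg_mem_pairingSpan`), proved by integrating by parts against the Gaussian weight
  (`integral_inner_mul_gaussianWeight`): one slot is contracted with each of the others in turn.
* If `T` is `O(n)`-invariant then `⟨T, A T⟩ ≥ 0`, with equality only for `T = 0`. By the polar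
  decomposition `X = Q P` one has `T (X ·) = T (P ·)`, and a positive semidefinite matrix `P = R R`
  acts on tensors as a positive semidefinite operator: `⟨T, T (P ·)⟩ = |T (R ·)|²`
  (`inner_components_pullback_nonneg`).

Hence an invariant tensor orthogonal to all products of Kronecker tensors vanishes
(`eq_zero_of_inner_kroneckerSpan`). Those products are themselves invariant, so subtracting from an
invariant tensor its orthogonal projection to their span gives zero
(`mem_kroneckerSpan_of_orthogonal`).

An `SO(n)`-invariant tensor is the sum of an `O(n)`-invariant one and a tensor `T` with
`T (Q ·) = det Q • T` for `Q ∈ O(n)`. For the latter, `T ⊗ ε` is `O(n)`-invariant, hence a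
combination of products of Kronecker tensors in `m + n` slots. Contracting the last `n` slots with
`ε` gives `n! • T` on one side. On the other side, a product that joins two of the last `n` slots
gives zero by antisymmetry, and any other product becomes a product of Kronecker tensors and one
Levi-Civita tensor (`IsPairing.swap_or_split`, `contractLeviCivita_isPairing`).
-/

open MeasureTheory

namespace IsotropicTensor

/-! ### Gaussian integrals of functions of polynomial growth -/

/-- Continuity together with a polynomial bound in the norm. -/
def HasPolyGrowth {E : Type*} [NormedAddCommGroup E] (h : E → ℝ) : Prop :=
  Continuous h ∧ ∃ (C : ℝ) (k : ℕ), ∀ x, |h x| ≤ C * (1 + ‖x‖) ^ k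

section Growth

variable {E : Type*} [NormedAddCommGroup E]

theorem HasPolyGrowth.mul {f g : E → ℝ} (hf : HasPolyGrowth f) (hg : HasPolyGrowth g) :
    HasPolyGrowth (fun x => f x * g x) := by
  obtain ⟨hf, C, k, hC⟩ := hf
  obtain ⟨hg, D, l, hD⟩ := hg
  refine ⟨hf.mul hg, C * D, k + l, fun x => ?_⟩
  have h := mul_le_mul (hC x) (hD x) (abs_nonneg _) ((abs_nonneg _).trans (hC x))
  rw [abs_mul]
  refine h.trans_eq ?_
  ring

theorem HasPolyGrowth.const (c : ℝ) : HasPolyGrowth (fun _ : E => c) :=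
  ⟨continuous_const, |c|, 0, fun x => by simp⟩

theorem HasPolyGrowth.add {f g : E → ℝ} (hf : HasPolyGrowth f) (hg : HasPolyGrowth g) :
    HasPolyGrowth (fun x => f x + g x) := by
  obtain ⟨hf, C, k, hC⟩ := hf
  obtain ⟨hg, D, l, hD⟩ := hg
  refine ⟨hf.add hg, |C| + |D|, k + l, fun x => ?_⟩
  have h1 : (1 : ℝ) ≤ 1 + ‖x‖ := by simp
  have h2 : (1 + ‖x‖) ^ k ≤ (1 + ‖x‖) ^ (k + l) := pow_le_pow_right₀ h1 (by omega)
  have h3 : (1 + ‖x‖) ^ l ≤ (1 + ‖x‖) ^ (k + l) := pow_le_pow_right₀ h1 (by omega)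
  have h4 : C * (1 + ‖x‖) ^ k ≤ |C| * (1 + ‖x‖) ^ (k + l) :=
    mul_le_mul (le_abs_self C) h2 (by positivity) (abs_nonneg _)
  have h5 : D * (1 + ‖x‖) ^ l ≤ |D| * (1 + ‖x‖) ^ (k + l) :=
    mul_le_mul (le_abs_self D) h3 (by positivity) (abs_nonneg _)
  have := abs_add_le (f x) (g x)
  linarith [hC x, hD x]

theorem HasPolyGrowth.sum {α : Type*} (s : Finset α) {f : α → E → ℝ}
    (hf : ∀ a ∈ s, HasPolyGrowth (f a)) : HasPolyGrowth (fun x => ∑ a ∈ s, f a x) := by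
  classical
  induction s using Finset.induction_on with
  | empty => simpa using HasPolyGrowth.const (E := E) 0
  | insert a s ha ih =>
    simp only [Finset.sum_insert ha]
    exact (hf a (by simp)).add (ih fun b hb => hf b (by simp [hb]))

theorem HasPolyGrowth.prod {α : Type*} (s : Finset α) {f : α → E → ℝ}
    (hf : ∀ a ∈ s, HasPolyGrowth (f a)) : HasPolyGrowth (fun x => ∏ a ∈ s, f a x) := by
  classical
  induction s using Finset.induction_on with
  | empty => simpa using HasPolyGrowth.const (E := E) 1
  | insert a s ha ih =>
    simp only [Finset.prod_insert ha]
    exact (hf a (by simp)).mul (ih fun b hb => hf b (by simp [hb]))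

theorem HasPolyGrowth.linear [NormedSpace ℝ E] (L : E →L[ℝ] ℝ) : HasPolyGrowth (fun x => L x) := by
  refine ⟨L.continuous, ‖L‖, 1, fun x => (L.le_opNorm x).trans ?_⟩
  have := norm_nonneg L
  nlinarith

end Growth

section Gaussian

variable {E : Type*} [NormedAddCommGroup E]

/-- The unnormalised standard Gaussian weight. -/
noncomputable def gaussianWeight (x : E) : ℝ := Real.exp (-(1 / 2) * ‖x‖ ^ 2)

theorem gaussianWeight_pos (x : E) : 0 < gaussianWeight x := Real.exp_pos _

theorem continuous_gaussianWeight : Continuous (gaussianWeight : E → ℝ) := by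
  unfold gaussianWeight; fun_prop

variable [InnerProductSpace ℝ E]

theorem hasFDerivAt_gaussianWeight (x : E) :
    HasFDerivAt gaussianWeight (-gaussianWeight x • innerSL ℝ x) x := by
  have h := (((hasStrictFDerivAt_norm_sq x).hasFDerivAt).const_mul (-(1 / 2) : ℝ)).exp
  refine h.congr_fderiv ?_
  ext y
  simp [gaussianWeight]

variable [FiniteDimensional ℝ E] [MeasurableSpace E] [BorelSpace E]

theorem HasPolyGrowth.integrable {h : E → ℝ} (hh : HasPolyGrowth h) :
    Integrable (fun x => h x * gaussianWeight x) := by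
  obtain ⟨hc, C, k, hC⟩ := hh
  have h0 : Integrable (fun x : E => Real.exp (-(1 / 4) * ‖x‖ ^ 2)) := by
    have := (GaussianFourier.integrable_cexp_neg_mul_sq_norm_add (V := E) (b := (1 / 4 : ℂ))
      (by norm_num) 0 0).norm
    refine this.congr (Filter.Eventually.of_forall fun x => ?_)
    simp [Complex.norm_exp, ← Complex.ofReal_pow]
  refine (h0.const_mul (|C| * (4 ^ k * (k.factorial * Real.exp 1)))).mono'
    (hc.mul continuous_gaussianWeight).aestronglyMeasurable (Filter.Eventually.of_forall fun x => ?_)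
  have h1 : (1 + ‖x‖) ^ k ≤ (4 * (1 + ‖x‖ ^ 2 / 4)) ^ k :=
    pow_le_pow_left₀ (by positivity) (by nlinarith [sq_nonneg (‖x‖ - 1)]) k
  have h2 := Real.pow_div_factorial_le_exp (1 + ‖x‖ ^ 2 / 4) (by positivity) k
  rw [div_le_iff₀ (by positivity)] at h2
  have h3 : (1 + ‖x‖) ^ k ≤ 4 ^ k * (Real.exp (1 + ‖x‖ ^ 2 / 4) * k.factorial) := by
    rw [mul_pow] at h1
    exact h1.trans (mul_le_mul_of_nonneg_left h2 (by positivity))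
  have h4 : Real.exp (1 + ‖x‖ ^ 2 / 4) * gaussianWeight x
      = Real.exp 1 * Real.exp (-(1 / 4) * ‖x‖ ^ 2) := by
    rw [gaussianWeight, ← Real.exp_add, ← Real.exp_add]
    congr 1; ring
  rw [Real.norm_eq_abs, abs_mul, abs_of_pos (gaussianWeight_pos x)]
  calc |h x| * gaussianWeight x
      ≤ (|C| * (4 ^ k * (Real.exp (1 + ‖x‖ ^ 2 / 4) * k.factorial))) * gaussianWeight x := by
        refine mul_le_mul_of_nonneg_right ((hC x).trans ?_) (gaussianWeight_pos x).le
        exact mul_le_mul (le_abs_self C) h3 (by positivity) (abs_nonneg _)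
    _ = |C| * (4 ^ k * k.factorial) * (Real.exp (1 + ‖x‖ ^ 2 / 4) * gaussianWeight x) := by ring
    _ = _ := by rw [h4]; ring

/-- Gaussian integration by parts (Stein's identity). -/
theorem integral_inner_mul_gaussianWeight {h h' : E → ℝ} (hh : HasPolyGrowth h)
    (hh' : HasPolyGrowth h') (D : E) (hd : ∀ x, HasLineDerivAt ℝ h (h' x) x D) :
    ∫ x, inner ℝ x D * h x * gaussianWeight x = ∫ x, h' x * gaussianWeight x := by
  have hD : HasPolyGrowth (fun x : E => inner ℝ x D) := by
    simpa [real_inner_comm] using HasPolyGrowth.linear (innerSL ℝ D)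
  have key := integral_bilinear_hasLineDerivAt_right_eq_neg_left_of_integrable
    (μ := (volume : Measure E)) (f := h) (f' := h') (g := gaussianWeight)
    (g' := fun x => -gaussianWeight x * inner ℝ x D) (v := D) (B := ContinuousLinearMap.mul ℝ ℝ)
    (by simpa using hh'.integrable)
    (by
      refine ((hD.mul hh).integrable.neg).congr (Filter.Eventually.of_forall fun x => ?_)
      simp
      ring)
    (by simpa using hh.integrable) (fun x _ => hd x)
    (fun x _ => by simpa using (hasFDerivAt_gaussianWeight x).hasLineDerivAt D)
  simp only [ContinuousLinearMap.mul_apply'] at key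
  rw [← neg_eq_iff_eq_neg, ← integral_neg] at key
  rw [← key]
  congr 1; ext x; ring

end Gaussian

/-! ### Multilinear forms along affine maps -/

section Multilinear

variable {ι : Type} [Fintype ι] {n : ℕ}

/-- Expansion of a tensor in its components. -/
theorem Tensor.apply_eq_sum [DecidableEq ι] (T : Tensor ι n) (v : ι → Fin n → ℝ) :
    T v = ∑ J : ι → Fin n, (∏ b, v b (J b)) * T (fun b => Pi.single (J b) 1) := by
  have h : v = fun b => ∑ j, v b j • (Pi.single j 1 : Fin n → ℝ) := by
    ext b j
    simp [Finset.sum_apply, Pi.single_apply]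
  conv_lhs => rw [h]
  rw [T.map_sum]
  refine Finset.sum_congr rfl fun J _ => ?_
  rw [T.map_smul_univ, smul_eq_mul]

theorem Tensor.continuous (T : Tensor ι n) : Continuous T := by
  classical
  have h : (T : (ι → Fin n → ℝ) → ℝ) = fun v => _ := funext T.apply_eq_sum
  rw [h]
  fun_prop

theorem HasPolyGrowth.tensor {E : Type*} [NormedAddCommGroup E] (T : Tensor ι n)
    {p : E → ι → Fin n → ℝ} (hp : ∀ b j, HasPolyGrowth (fun x => p x b j)) :
    HasPolyGrowth (fun x => T (p x)) := by
  classical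
  have h : (fun x => T (p x)) = fun x => _ := funext fun x => T.apply_eq_sum (p x)
  rw [h]
  exact .sum _ fun J _ => .mul (.prod _ fun b _ => hp b (J b)) (.const _)

theorem Tensor.hasLineDerivAt [DecidableEq ι] {E : Type*} [NormedAddCommGroup E] [NormedSpace ℝ E]
    (T : Tensor ι n) {p : E → ι → Fin n → ℝ} {q : ι → Fin n → ℝ} {x D : E}
    (hp : ∀ t : ℝ, p (x + t • D) = p x + t • q) :
    HasLineDerivAt ℝ (fun y => T (p y)) (∑ b, T (Function.update (p x) b (q b))) x D := by
  let T' : ContinuousMultilinearMap ℝ (fun _ : ι => Fin n → ℝ) ℝ := ⟨T, T.continuous⟩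
  have h1 : HasDerivAt (fun t : ℝ => p x + t • q) q 0 := by
    simpa using ((hasDerivAt_id (0 : ℝ)).smul_const q).const_add (p x)
  have h2 := (T'.hasFDerivAt (p x + (0 : ℝ) • q)).comp_hasDerivAt (0 : ℝ) h1
  unfold HasLineDerivAt
  simp only [hp]
  convert! h2 using 1
  simp [T']
  rfl

end Multilinear

/-! ### Products of scalar products over a set of slots -/

section Pairing

variable {ι : Type} [DecidableEq ι] {n : ℕ}

/-- `IsPairing s f` says that `f u` is a product of scalar products `⟨u a, u b⟩` over the pairs
`{a, b}` of a partition of the finite set `s` of slots into pairs. -/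
inductive IsPairing : Finset ι → ((ι → Fin n → ℝ) → ℝ) → Prop
  | empty : IsPairing ∅ (fun _ => 1)
  | insertPair {s : Finset ι} {f : (ι → Fin n → ℝ) → ℝ} {a b : ι} (hab : a ≠ b) (ha : a ∉ s)
      (hb : b ∉ s) (hf : IsPairing s f) :
      IsPairing (insert a (insert b s)) (fun u => (u a ⬝ᵥ u b) * f u)

/-- A pairing of `s` is an injective labelling of `s` by the legs of `k` Kronecker tensors. -/
theorem IsPairing.exists_legs {s : Finset ι} {f : (ι → Fin n → ℝ) → ℝ} (h : IsPairing s f) :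
    ∃ (k : ℕ) (e : Fin k × Fin 2 → ι), Function.Injective e ∧ (∀ i, i ∈ s ↔ i ∈ Set.range e) ∧
      ∀ u, f u = ∏ j, u (e (j, 0)) ⬝ᵥ u (e (j, 1)) := by
  induction h with
  | empty => exact ⟨0, fun p => p.1.elim0, fun p => p.1.elim0, by simp, by simp⟩
  | @insertPair s f a b hab ha hb _ ih =>
    obtain ⟨k, e, he, hs, hf⟩ := ih
    have ha' : ∀ p, e p ≠ a := fun p hp => ha ((hs a).2 ⟨p, hp⟩)
    have hb' : ∀ p, e p ≠ b := fun p hp => hb ((hs b).2 ⟨p, hp⟩)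
    refine ⟨k + 1, fun p => Fin.cases (![a, b] p.2) (fun j => e (j, p.2)) p.1, ?_, ?_, ?_⟩
    · rintro ⟨i, x⟩ ⟨j, y⟩
      refine Fin.cases ?_ (fun i => ?_) i <;> refine Fin.cases ?_ (fun j => ?_) j
      · fin_cases x <;> fin_cases y <;> simp [hab, hab.symm]
      · fin_cases x <;> simp [(ha' _).symm, (hb' _).symm]
      · fin_cases y <;> simp [ha', hb']
      · intro h
        have := he h
        simp_all
    · intro i
      simp only [Finset.mem_insert, hs, Set.mem_range, Prod.exists, Fin.exists_fin_succ]
      simp [eq_comm, or_assoc]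
    · intro u
      simp [Fin.prod_univ_succ, hf]

/-- The functions of vectors that are linear combinations of pairings of `s`. -/
def pairingSpan (n : ℕ) (s : Finset ι) : Submodule ℝ ((ι → Fin n → ℝ) → ℝ) :=
  Submodule.span ℝ {f | IsPairing s f}

theorem pairingSpan_insert {s : Finset ι} {f : (ι → Fin n → ℝ) → ℝ} {a b : ι} (hab : a ≠ b)
    (ha : a ∉ s) (hb : b ∉ s) (hf : f ∈ pairingSpan n s) :
    (fun u => (u a ⬝ᵥ u b) * f u) ∈ pairingSpan n (insert a (insert b s)) := by
  have h : (pairingSpan n s).map (LinearMap.mulLeft ℝ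
      (fun u : ι → Fin n → ℝ => u a ⬝ᵥ u b)) ≤ pairingSpan n (insert a (insert b s)) := by
    rw [pairingSpan, Submodule.map_span, Submodule.span_le]
    rintro _ ⟨g, hg, rfl⟩
    exact Submodule.subset_span (.insertPair hab ha hb hg)
  exact h ⟨f, hf, rfl⟩

end Pairing

/-! ### Wick's theorem -/

/-- The `n × n` matrix whose entries are the coordinates of a vector of a Euclidean space; the
Euclidean norm is the Frobenius norm. -/
def toMatrix {n : ℕ} (X : EuclideanSpace ℝ (Fin n × Fin n)) : Matrix (Fin n) (Fin n) ℝ :=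
  Matrix.of fun i j => X (i, j)

section Wick

variable {ι : Type} [DecidableEq ι] {n : ℕ}

theorem hasPolyGrowth_toMatrix_mulVec (v : Fin n → ℝ) (j : Fin n) :
    HasPolyGrowth (fun X => (toMatrix X *ᵥ v) j) := by
  simp only [Matrix.mulVec, dotProduct, toMatrix, Matrix.of_apply]
  exact .sum _ fun i _ => .mul
    (HasPolyGrowth.linear (EuclideanSpace.proj (𝕜 := ℝ) (j, i))) (.const _)

/-- The vectors `X v_b` in the slots `b ∈ s`, and the vectors `x_b` in the other slots. -/
def mixedArg (s : Finset ι) (v x : ι → Fin n → ℝ) (X : EuclideanSpace ℝ (Fin n × Fin n)) :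
    ι → Fin n → ℝ :=
  fun b => if b ∈ s then toMatrix X *ᵥ v b else x b

variable [Fintype ι]

theorem hasPolyGrowth_mixedArg (T : Tensor ι n) (s : Finset ι) (v x : ι → Fin n → ℝ) :
    HasPolyGrowth (fun X => T (mixedArg s v x X)) := by
  refine .tensor T fun b j => ?_
  unfold mixedArg
  split_ifs
  · exact hasPolyGrowth_toMatrix_mulVec _ _
  · exact .const _

/-- The slot `a` is contracted with each of the other averaged slots `b`: expanding `X v_a` in
coordinates and integrating by parts along `D i` replaces `X v_b` by
`(D i) v_b = ⟨v_a, v_b⟩ e_i`. -/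
theorem integral_mixedArg_insert (T : Tensor ι n) {s : Finset ι} {a : ι} (ha : a ∉ s)
    (v x : ι → Fin n → ℝ) :
    ∫ X, T (mixedArg (insert a s) v x X) * gaussianWeight X =
      ∑ b ∈ s, (v a ⬝ᵥ v b) * ∑ i, ∫ X, T (mixedArg (s.erase b) v
        (Function.update (Function.update x a (Pi.single i 1)) b (Pi.single i 1)) X) *
          gaussianWeight X := by
  -- `D i` is the gradient of the linear function `X ↦ (X v_a)_i` on the space of matrices
  let D : Fin n → EuclideanSpace ℝ (Fin n × Fin n) :=
    fun i => WithLp.toLp 2 fun p => if p.1 = i then v a p.2 else 0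
  let y : Fin n → ι → Fin n → ℝ := fun i => Function.update x a (Pi.single i 1)
  have hD : ∀ i X, inner ℝ X (D i) = (toMatrix X *ᵥ v a) i := by
    intro i X
    simp [D, PiLp.inner_apply, Fintype.sum_prod_type, Matrix.mulVec, dotProduct, toMatrix,
      mul_comm]
  have hDv : ∀ i b, toMatrix (D i) *ᵥ v b = (v a ⬝ᵥ v b) • Pi.single i 1 := by
    intro i b
    ext k
    by_cases hk : k = i <;> simp [hk, D, Matrix.mulVec, dotProduct, toMatrix]
  have h1 : ∀ X, T (mixedArg (insert a s) v x X) =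
      ∑ i, inner ℝ X (D i) * T (mixedArg s v (y i) X) := by
    intro X
    have e1 : ∀ w, Function.update (mixedArg s v x X) a w =
        mixedArg s v (Function.update x a w) X := by
      intro w
      ext b : 1
      by_cases hb : b = a
      · subst hb; simp [mixedArg, ha]
      · simp [mixedArg, hb]
    have e2 : mixedArg (insert a s) v x X = Function.update (mixedArg s v x X) a
        (∑ i, (toMatrix X *ᵥ v a) i • Pi.single i 1) := by
      rw [← pi_eq_sum_univ' (toMatrix X *ᵥ v a)]
      ext b : 1
      by_cases hb : b = a
      · subst hb; simp [mixedArg]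
      · simp [mixedArg, hb]
    rw [e2, T.map_update_sum]
    refine Finset.sum_congr rfl fun i _ => ?_
    rw [T.map_update_smul, e1, hD, smul_eq_mul]
  have hline : ∀ i X (t : ℝ), mixedArg s v (y i) (X + t • D i) =
      mixedArg s v (y i) X + t • fun b => if b ∈ s then (v a ⬝ᵥ v b) • Pi.single i 1 else 0 := by
    intro i X t
    ext b : 1
    have : toMatrix (X + t • D i) = toMatrix X + t • toMatrix (D i) := rfl
    by_cases hb : b ∈ s
    · simp [mixedArg, hb, this, Matrix.add_mulVec, Matrix.smul_mulVec, hDv]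
    · simp [mixedArg, hb]
  have h2 : ∀ i X, ∑ b, T (Function.update (mixedArg s v (y i) X) b
      (if b ∈ s then (v a ⬝ᵥ v b) • Pi.single i 1 else 0)) =
      ∑ b ∈ s, (v a ⬝ᵥ v b) *
        T (mixedArg (s.erase b) v (Function.update (y i) b (Pi.single i 1)) X) := by
    intro i X
    rw [← Finset.sum_subset (Finset.subset_univ s)
      (fun b _ hb => by rw [if_neg hb]; exact T.map_update_zero _ _)]
    refine Finset.sum_congr rfl fun b hb => ?_
    rw [if_pos hb, T.map_update_smul, smul_eq_mul]
    congr 2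
    ext c : 1
    by_cases hc : c = b
    · subst hc; simp [mixedArg]
    · simp [mixedArg, hc]
  have hint : ∀ s x, Integrable fun X => T (mixedArg s v x X) * gaussianWeight X :=
    fun s x => (hasPolyGrowth_mixedArg T s v x).integrable
  have stein : ∀ i, ∫ X, inner ℝ X (D i) * T (mixedArg s v (y i) X) * gaussianWeight X =
      ∑ b ∈ s, (v a ⬝ᵥ v b) * ∫ X, T (mixedArg (s.erase b) v
        (Function.update (y i) b (Pi.single i 1)) X) * gaussianWeight X := by
    intro i
    rw [integral_inner_mul_gaussianWeight (hasPolyGrowth_mixedArg T s v (y i))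
      (h' := fun X => ∑ b ∈ s, (v a ⬝ᵥ v b) * T (mixedArg (s.erase b) v
        (Function.update (y i) b (Pi.single i 1)) X))
      (.sum _ fun b _ => .mul (.const _) (hasPolyGrowth_mixedArg T _ v _)) (D i)
      (fun X => by rw [← h2]; exact T.hasLineDerivAt (hline i X))]
    simp only [Finset.sum_mul, mul_assoc]
    rw [integral_finsetSum _ fun b _ => (hint _ _).const_mul _]
    simp only [integral_const_mul]
  simp only [h1, Finset.sum_mul]
  rw [integral_finsetSum]
  · simp only [stein, Finset.mul_sum]
    rw [Finset.sum_comm]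
  · intro i _
    refine HasPolyGrowth.integrable (.mul ?_ (hasPolyGrowth_mixedArg T s v (y i)))
    simp only [hD]
    exact hasPolyGrowth_toMatrix_mulVec _ _

/-- **Wick's theorem**: the Gaussian average over `X` of a tensor with `X v_b` in the slots
`b ∈ s` is a combination of products of scalar products of the `v_b`. -/
theorem integral_mixedArg_mem_pairingSpan (T : Tensor ι n) (s : Finset ι) (x : ι → Fin n → ℝ) :
    (fun v => ∫ X, T (mixedArg s v x X) * gaussianWeight X) ∈ pairingSpan n s := by
  induction s using Finset.strongInduction generalizing x with
  | H s ih =>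
    obtain rfl | ⟨a, ha⟩ := s.eq_empty_or_nonempty
    · have : (fun v : ι → Fin n → ℝ => ∫ X, T (mixedArg ∅ v x X) * gaussianWeight X) =
          (∫ X, T x * gaussianWeight (E := EuclideanSpace ℝ (Fin n × Fin n)) X) • fun _ => 1 := by
        ext v
        have : mixedArg ∅ v x = fun _ => x := by ext; simp [mixedArg]
        simp [this]
      rw [this]
      exact Submodule.smul_mem _ _ (Submodule.subset_span .empty)
    · obtain ⟨s, ha', rfl⟩ : ∃ t, a ∉ t ∧ insert a t = s :=
        ⟨s.erase a, s.notMem_erase a, Finset.insert_erase ha⟩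
      simp only [integral_mixedArg_insert T ha', ← Finset.sum_fn]
      refine Submodule.sum_mem _ fun b hb => ?_
      have hab : a ≠ b := fun h => ha' (h ▸ hb)
      have hs : insert a s = insert a (insert b (s.erase b)) := by rw [Finset.insert_erase hb]
      rw [hs]
      refine pairingSpan_insert hab (fun h => ha' (Finset.mem_of_mem_erase h))
        (s.notMem_erase b) ?_
      simp only [← Finset.sum_fn]
      refine Submodule.sum_mem _ fun i _ => ih _ ?_ _
      refine (Finset.erase_ssubset hb).trans_subset (Finset.subset_insert _ _)

end Wick

/-! ### The orthogonal group -/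

section Orthogonal

variable {ι : Type} {n : ℕ}

/-- The components of a tensor, as a vector of a Euclidean space. -/
noncomputable def components : Tensor ι n →ₗ[ℝ] EuclideanSpace ℝ (ι → Fin n) where
  toFun T := WithLp.toLp 2 fun J => T fun b => Pi.single (J b) 1
  map_add' _ _ := rfl
  map_smul' _ _ := rfl

theorem components_apply (T : Tensor ι n) (J : ι → Fin n) :
    components T J = T fun b => Pi.single (J b) 1 := rfl

theorem components_injective [Finite ι] :
    Function.Injective (components (ι := ι) (n := n)) := by
  classical
  have := Fintype.ofFinite ι
  intro S T h
  refine MultilinearMap.ext fun v => ?_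
  rw [S.apply_eq_sum, T.apply_eq_sum]
  exact Finset.sum_congr rfl fun J _ => congrArg _ (congrArg (fun w => w.ofLp J) h)

/-- The action of a matrix on tensors: `(T · S) (u₁, …, uₘ) = T (S u₁, …, S uₘ)`. -/
noncomputable def pullback (S : Matrix (Fin n) (Fin n) ℝ) (T : Tensor ι n) : Tensor ι n :=
  T.compLinearMap fun _ => S.mulVecLin

theorem pullback_apply (S : Matrix (Fin n) (Fin n) ℝ) (T : Tensor ι n) (u : ι → Fin n → ℝ) :
    pullback S T u = T fun b => S *ᵥ u b := rfl

theorem pullback_mul (R S : Matrix (Fin n) (Fin n) ℝ) (T : Tensor ι n) :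
    pullback (R * S) T = pullback S (pullback R T) := by
  refine MultilinearMap.ext fun u => ?_
  simp [pullback_apply]

theorem pullback_one (T : Tensor ι n) : pullback 1 T = T := by
  refine MultilinearMap.ext fun u => ?_
  simp [pullback_apply]

/-- The span of the products of Kronecker tensors with slots indexed by `ι`. -/
def kroneckerSpan (ι : Type) (n : ℕ) : Submodule ℝ (Tensor ι n) :=
  Submodule.span ℝ {T | ∃ (k : ℕ) (e : Fin k × Fin 2 ≃ ι), T = (kroneckerPower k n).domDomCongr e}

theorem kroneckerPower_domDomCongr_apply {k : ℕ} (e : Fin k × Fin 2 ≃ ι) (u : ι → Fin n → ℝ) :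
    (kroneckerPower k n).domDomCongr e u = ∏ j, u (e (j, 0)) ⬝ᵥ u (e (j, 1)) := rfl

theorem pullback_of_mem_kroneckerSpan {T : Tensor ι n} (hT : T ∈ kroneckerSpan ι n)
    {Q : Matrix (Fin n) (Fin n) ℝ} (hQ : Q ∈ Matrix.orthogonalGroup (Fin n) ℝ) :
    pullback Q T = T := by
  induction hT using Submodule.span_induction with
  | mem T h =>
    obtain ⟨k, e, rfl⟩ := h
    refine MultilinearMap.ext fun u => ?_
    rw [pullback_apply, kroneckerPower_domDomCongr_apply, kroneckerPower_domDomCongr_apply]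
    refine Finset.prod_congr rfl fun j _ => ?_
    rw [Matrix.dotProduct_mulVec, Matrix.vecMul_mulVec, (Matrix.mem_orthogonalGroup_iff' _ _).1 hQ,
      Matrix.vecMul_one]
  | zero => rfl
  | add S T _ _ hS hT => exact congrArg₂ (· + ·) hS hT
  | smul c T _ hT => exact congrArg (c • ·) hT

variable [Fintype ι] [DecidableEq ι]

/-- The adjoint of the action of `S` on tensors is the action of its transpose. -/
theorem inner_components_pullback (S : Matrix (Fin n) (Fin n) ℝ) (T U : Tensor ι n) :
    inner ℝ (components T) (components (pullback S U)) =
      inner ℝ (components (pullback Sᵀ T)) (components U) := by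
  have h : ∀ (S : Matrix (Fin n) (Fin n) ℝ) (T : Tensor ι n) J, components (pullback S T) J =
      ∑ K : ι → Fin n, (∏ b, S (K b) (J b)) * components T K := by
    intro S T J
    rw [components_apply, pullback_apply, Tensor.apply_eq_sum]
    simp [components_apply]
  simp only [PiLp.inner_apply, h, RCLike.inner_apply, conj_trivial, Finset.mul_sum, Finset.sum_mul]
  rw [Finset.sum_comm]
  refine Finset.sum_congr rfl fun K _ => Finset.sum_congr rfl fun J _ => ?_
  simp only [Matrix.transpose_apply]
  ring

/-- For an invertible matrix `X = Q P` in polar form, `T · X = T · P`, and the positive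
semidefinite `P` acts on tensors as a positive semidefinite operator. -/
theorem inner_components_pullback_nonneg_of_isUnit {T : Tensor ι n}
    (hT : ∀ Q ∈ Matrix.orthogonalGroup (Fin n) ℝ, pullback Q T = T)
    {X : Matrix (Fin n) (Fin n) ℝ} (hX : IsUnit X.det) :
    0 ≤ inner ℝ (components T) (components (pullback X T)) := by
  open scoped MatrixOrder in
  obtain ⟨P, hP, hPP⟩ : ∃ P : Matrix (Fin n) (Fin n) ℝ, P.PosSemidef ∧ P * P = Xᵀ * X := by
    have h : 0 ≤ Xᵀ * X := by
      rw [Matrix.nonneg_iff_posSemidef]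
      simpa using Matrix.posSemidef_conjTranspose_mul_self X
    exact ⟨CFC.sqrt (Xᵀ * X), Matrix.nonneg_iff_posSemidef.1 (CFC.sqrt_nonneg _),
      CFC.sqrt_mul_sqrt_self _ h⟩
  obtain ⟨R, hR, hRR⟩ : ∃ R : Matrix (Fin n) (Fin n) ℝ, R.PosSemidef ∧ R * R = P :=
    ⟨CFC.sqrt P, Matrix.nonneg_iff_posSemidef.1 (CFC.sqrt_nonneg _),
      CFC.sqrt_mul_sqrt_self _ (Matrix.nonneg_iff_posSemidef.2 hP)⟩
  have hPt : Pᵀ = P := by simpa using hP.1.eq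
  have hRt : Rᵀ = R := by simpa using hR.1.eq
  have hPu : IsUnit P.det := by
    have : P.det * P.det = X.det * X.det := by
      rw [← Matrix.det_mul, hPP, Matrix.det_mul, Matrix.det_transpose]
    exact isUnit_of_mul_isUnit_left (this ▸ hX.mul hX)
  have hQ : X * P⁻¹ ∈ Matrix.orthogonalGroup (Fin n) ℝ := by
    rw [Matrix.mem_orthogonalGroup_iff', Matrix.transpose_mul, Matrix.transpose_nonsing_inv, hPt]
    calc P⁻¹ * Xᵀ * (X * P⁻¹) = P⁻¹ * (Xᵀ * X) * P⁻¹ := by simp only [Matrix.mul_assoc]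
      _ = (P⁻¹ * P) * (P * P⁻¹) := by rw [← hPP]; simp only [Matrix.mul_assoc]
      _ = 1 := by rw [Matrix.nonsing_inv_mul _ hPu, Matrix.mul_nonsing_inv _ hPu, one_mul]
  have hXP : X = X * P⁻¹ * R * R := by
    rw [Matrix.mul_assoc, hRR, Matrix.mul_assoc, Matrix.nonsing_inv_mul _ hPu, mul_one]
  rw [hXP, pullback_mul, pullback_mul, hT _ hQ, inner_components_pullback, hRt]
  exact real_inner_self_nonneg

theorem continuous_inner_components_pullback (T U : Tensor ι n) :
    Continuous fun X : Matrix (Fin n) (Fin n) ℝ =>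
      inner ℝ (components T) (components (pullback X U)) := by
  simp only [PiLp.inner_apply, components_apply, pullback_apply]
  refine continuous_finsetSum _ fun J _ => ?_
  refine Continuous.inner continuous_const (U.continuous.comp ?_)
  fun_prop

/-- The matrices with nonzero determinant being dense, the sign extends to all matrices. -/
theorem inner_components_pullback_nonneg {T : Tensor ι n}
    (hT : ∀ Q ∈ Matrix.orthogonalGroup (Fin n) ℝ, pullback Q T = T)
    (X : Matrix (Fin n) (Fin n) ℝ) :
    0 ≤ inner ℝ (components T) (components (pullback X T)) := by
  -- `t + X` is singular only at the finitely many roots `t` of the characteristic polynomial of `-X`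
  have h1 : ∀ᶠ t : ℝ in nhdsWithin 0 {0}ᶜ, IsUnit (Matrix.scalar (Fin n) t - -X).det := by
    have h2 : ∀ᶠ t : ℝ in Filter.cofinite, (-X).charpoly.eval t ≠ 0 := by
      have := (-X).charpoly.roots.toFinset.finite_toSet
      refine this.subset fun t ht => ?_
      simpa [Matrix.charpoly_monic, (Matrix.charpoly_monic _).ne_zero] using ht
    refine Filter.Eventually.mono (nhdsNE_le_cofinite 0 h2) fun t ht => ?_
    rwa [Matrix.eval_charpoly, ← isUnit_iff_ne_zero] at ht
  have h3 : Filter.Tendsto (fun t : ℝ => Matrix.scalar (Fin n) t - -X) (nhdsWithin 0 {0}ᶜ)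
      (nhds X) := by
    have h4 : Continuous (fun t : ℝ => Matrix.scalar (Fin n) t - -X) := by
      simp only [Matrix.scalar_apply]
      fun_prop
    have := h4.tendsto 0
    simp only [map_zero, zero_sub, neg_neg] at this
    exact this.mono_left nhdsWithin_le_nhds
  exact ge_of_tendsto (((continuous_inner_components_pullback T T).tendsto X).comp h3)
    (h1.mono fun t ht => inner_components_pullback_nonneg_of_isUnit hT ht)

theorem exists_mem_kroneckerSpan {f : (ι → Fin n → ℝ) → ℝ}
    (hf : f ∈ pairingSpan n Finset.univ) : ∃ T ∈ kroneckerSpan ι n, ⇑T = f := by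
  induction hf using Submodule.span_induction with
  | mem f h =>
    obtain ⟨k, e, he, hs, hf⟩ := IsPairing.exists_legs h
    let e' := Equiv.ofBijective e ⟨he, fun i => (hs i).1 (Finset.mem_univ i)⟩
    exact ⟨_, Submodule.subset_span ⟨k, e', rfl⟩, funext fun u => (hf u).symm⟩
  | zero => exact ⟨0, zero_mem _, rfl⟩
  | add f g _ _ hf hg =>
    obtain ⟨S, hS, rfl⟩ := hf
    obtain ⟨T, hT, rfl⟩ := hg
    exact ⟨S + T, add_mem hS hT, rfl⟩
  | smul c f _ hf =>
    obtain ⟨S, hS, rfl⟩ := hf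
    exact ⟨c • S, Submodule.smul_mem _ _ hS, rfl⟩

theorem exists_mem_kroneckerSpan_eq_integral (T : Tensor ι n) :
    ∃ K ∈ kroneckerSpan ι n, ∀ v, K v = ∫ X, pullback (toMatrix X) T v * gaussianWeight X := by
  obtain ⟨K, hK, h⟩ :=
    exists_mem_kroneckerSpan (integral_mixedArg_mem_pairingSpan T Finset.univ 0)
  refine ⟨K, hK, fun v => ?_⟩
  have hm : ∀ X, mixedArg Finset.univ v 0 X = fun b => toMatrix X *ᵥ v b := fun X => by
    ext; simp [mixedArg]
  simp only [h, hm, pullback_apply]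

/-- An `O(n)`-invariant tensor orthogonal to all products of Kronecker tensors is zero: its
Gaussian average `E ⟨T, T · X⟩` vanishes by Wick's theorem, and the integrand is nonnegative, with
value `|T|²` at the identity matrix. -/
theorem eq_zero_of_inner_kroneckerSpan {T : Tensor ι n}
    (hT : ∀ Q ∈ Matrix.orthogonalGroup (Fin n) ℝ, pullback Q T = T)
    (hK : ∀ K ∈ kroneckerSpan ι n, inner ℝ (components T) (components K) = 0) : T = 0 := by
  obtain ⟨K, hK', hint⟩ := exists_mem_kroneckerSpan_eq_integral T
  set F : EuclideanSpace ℝ (Fin n × Fin n) → ℝ :=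
    fun X => inner ℝ (components T) (components (pullback (toMatrix X) T)) with hF
  have hterm : ∀ J : ι → Fin n, HasPolyGrowth fun X =>
      components T J * components (pullback (toMatrix X) T) J := fun J =>
    .mul (.const _) (.tensor T fun b j => hasPolyGrowth_toMatrix_mulVec _ _)
  have hFsum : F = fun X => ∑ J, components T J * components (pullback (toMatrix X) T) J := by
    ext X
    simp [hF, PiLp.inner_apply, mul_comm]
  have hFg : HasPolyGrowth F := by
    rw [hFsum]
    exact .sum _ fun J _ => hterm J
  have h0 : ∫ X, F X * gaussianWeight X = 0 := by
    rw [← hK K hK', PiLp.inner_apply, hFsum]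
    simp only [Finset.sum_mul]
    rw [integral_finsetSum _ fun J _ => (hterm J).integrable]
    refine Finset.sum_congr rfl fun J _ => ?_
    simp only [mul_assoc, integral_const_mul, components_apply K, hint]
    simp [mul_comm, components_apply]
  have h1 := (integral_eq_zero_iff_of_nonneg
    (fun X => mul_nonneg (inner_components_pullback_nonneg hT _) (gaussianWeight_pos X).le)
    hFg.integrable).1 h0
  have h2 := ((hFg.1.mul continuous_gaussianWeight).ae_eq_iff_eq volume continuous_const).1 h1
  have h3 := congrFun h2 (WithLp.toLp 2 fun p => if p.1 = p.2 then 1 else 0)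
  have h4 : toMatrix
      (WithLp.toLp 2 fun p : Fin n × Fin n => if p.1 = p.2 then (1 : ℝ) else 0) = 1 := by
    ext i j
    simp [toMatrix, Matrix.one_apply]
  have h5 := (mul_eq_zero.1 h3).resolve_right (gaussianWeight_pos _).ne'
  rw [hF] at h5
  simp only [h4, pullback_one] at h5
  exact components_injective (by simpa using h5)

/-- **First fundamental theorem for `O(n)`**, for tensors with slots in any finite type. -/
theorem mem_kroneckerSpan_of_orthogonal {T : Tensor ι n}
    (hT : ∀ Q ∈ Matrix.orthogonalGroup (Fin n) ℝ, pullback Q T = T) :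
    T ∈ kroneckerSpan ι n := by
  obtain ⟨w, ⟨K, hK, rfl⟩, z, hz, h⟩ :=
    ((kroneckerSpan ι n).map components).exists_add_mem_mem_orthogonal (components T)
  have hr : components (T - K) = z := by rw [map_sub, h]; abel
  have : T - K = 0 := by
    refine eq_zero_of_inner_kroneckerSpan (fun Q hQ => ?_) fun L hL => ?_
    · exact congrArg₂ (· - ·) (hT Q hQ) (pullback_of_mem_kroneckerSpan hK hQ)
    · rw [hr, real_inner_comm]
      exact (Submodule.mem_orthogonal _ _).1 hz _ ⟨L, hL, rfl⟩
  rwa [sub_eq_zero.1 this]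

end Orthogonal

/-! ### The special orthogonal group -/

section Split

variable {ι : Type} [DecidableEq ι] {n : ℕ}

theorem isPairing_of_injective {k : ℕ} (e : Fin k × Fin 2 → ι) (he : Function.Injective e) :
    IsPairing (Finset.univ.image e)
      (fun u : ι → Fin n → ℝ => ∏ j, u (e (j, 0)) ⬝ᵥ u (e (j, 1))) := by
  induction k with
  | zero => simpa using IsPairing.empty
  | succ k ih =>
    have h := ih (fun p => e (p.1.succ, p.2)) fun p q hpq => by
      have := he hpq
      simpa [Prod.ext_iff] using this
    have h' := h.insertPair (a := e (0, 0)) (b := e (0, 1)) (fun h => by simpa using he h)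
      (by simp [he.eq_iff]) (by simp [he.eq_iff])
    simp only [Fin.prod_univ_succ]
    convert! h' using 1
    ext i
    simp [Fin.exists_fin_succ, eq_comm, or_assoc]

theorem coe_mem_pairingSpan [Fintype ι] {T : Tensor ι n} (hT : T ∈ kroneckerSpan ι n) :
    ⇑T ∈ pairingSpan n (Finset.univ : Finset ι) := by
  induction hT using Submodule.span_induction with
  | mem T h =>
    obtain ⟨k, e, rfl⟩ := h
    have := isPairing_of_injective (n := n) e e.injective
    rw [Finset.image_univ_equiv] at this
    exact Submodule.subset_span this
  | zero => exact zero_mem _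
  | add S T _ _ hS hT => exact add_mem hS hT
  | smul c T _ hT => exact Submodule.smul_mem _ c hT

theorem IsPairing.congr {s : Finset ι} {f : (ι → Fin n → ℝ) → ℝ} (h : IsPairing s f)
    {u v : ι → Fin n → ℝ} (huv : ∀ b ∈ s, u b = v b) : f u = f v := by
  induction h with
  | empty => rfl
  | @insertPair s f a b _ _ _ _ ih =>
    simp only [huv a (by simp), huv b (by simp), ih fun c hc => huv c (by simp [hc])]

/-- A pairing of slots of two kinds either joins two slots of the second kind, and is then
invariant under their exchange, or joins each slot `j` of the second kind in its domain to a slot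
`c j` of the first kind, the remaining slots of the first kind being paired among themselves. Here
`t` and `r` are the slots of the second kind and the remaining slots of the first kind in `s`; the
values of `c` outside `t` play no role. -/
theorem IsPairing.swap_or_split [Nonempty ι] {s : Finset (ι ⊕ Fin n)}
    {f : (ι ⊕ Fin n → Fin n → ℝ) → ℝ} (h : IsPairing s f) :
    (∃ i j, i ≠ j ∧ Sum.inr i ∈ s ∧ Sum.inr j ∈ s ∧
      ∀ u, f (fun b => u (Equiv.swap (Sum.inr i) (Sum.inr j) b)) = f u) ∨
    ∃ (t : Finset (Fin n)) (c : Fin n → ι) (r : Finset ι) (g : (ι → Fin n → ℝ) → ℝ),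
      IsPairing r g ∧ Set.InjOn c t ∧ (∀ j ∈ t, c j ∉ r) ∧ (∀ j, Sum.inr j ∈ s ↔ j ∈ t) ∧
      (∀ a, Sum.inl a ∈ s ↔ a ∈ r ∨ ∃ j ∈ t, c j = a) ∧
      ∀ u, f u = g (fun a => u (Sum.inl a)) * ∏ j ∈ t, u (Sum.inl (c j)) ⬝ᵥ u (Sum.inr j) := by
  induction h with
  | empty => exact .inr ⟨∅, fun _ => Classical.arbitrary ι, ∅, _, .empty, by simp⟩
  | @insertPair s f a b hab ha hb hf ih =>
    obtain ⟨i, j, hij, hi, hj, hu⟩ | ⟨t, c, r, g, hg, hc, hcr, hst, hsr, hfg⟩ := ih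
    · refine .inl ⟨i, j, hij, by simp [hi], by simp [hj], fun u => ?_⟩
      have hne : ∀ x ∉ s, Equiv.swap (Sum.inr i) (Sum.inr j) x = x := fun x hx =>
        Equiv.swap_apply_of_ne_of_ne (fun h => hx (h ▸ hi)) (fun h => hx (h ▸ hj))
      simp only [hne a ha, hne b hb, hu]
    -- a new slot of the first kind joined to a new slot of the second kind
    have mixed : ∀ (a : ι) (b : Fin n), Sum.inl a ∉ s → Sum.inr b ∉ s →
        ∃ (t' : Finset (Fin n)) (c' : Fin n → ι) (r' : Finset ι) (g' : (ι → Fin n → ℝ) → ℝ),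
        IsPairing r' g' ∧ Set.InjOn c' t' ∧ (∀ j ∈ t', c' j ∉ r') ∧
        (∀ j, Sum.inr j ∈ insert (Sum.inl a) (insert (Sum.inr b) s) ↔ j ∈ t') ∧
        (∀ x, Sum.inl x ∈ insert (Sum.inl a) (insert (Sum.inr b) s) ↔
          x ∈ r' ∨ ∃ j ∈ t', c' j = x) ∧
        ∀ u, (u (Sum.inl a) ⬝ᵥ u (Sum.inr b)) * f u =
          g' (fun a => u (Sum.inl a)) * ∏ j ∈ t', u (Sum.inl (c' j)) ⬝ᵥ u (Sum.inr j) := by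
      intro a b ha hb
      rw [hsr, not_or] at ha
      rw [hst] at hb
      have hcu : ∀ j ∈ t, Function.update c b a j = c j := fun j hj =>
        Function.update_of_ne (fun h : j = b => hb (h ▸ hj)) _ _
      refine ⟨insert b t, Function.update c b a, r, g, hg, ?_, ?_, ?_, ?_, ?_⟩
      · rw [Finset.coe_insert, Set.injOn_insert (by simpa using hb)]
        refine ⟨fun x hx y hy h => hc hx hy ?_, ?_⟩
        · rwa [hcu x hx, hcu y hy] at h
        · rintro ⟨x, hx, h⟩
          rw [hcu x hx, Function.update_self] at h
          exact ha.2 ⟨x, hx, h⟩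
      · intro j hj
        obtain rfl | hj := Finset.mem_insert.1 hj
        · simpa using ha.1
        · rw [hcu j hj]; exact hcr j hj
      · simp [hst]
      · intro x
        simp only [Finset.mem_insert, Sum.inl.injEq, reduceCtorEq, false_or, hsr]
        grind
      · intro u
        have : ∏ j ∈ t, u (Sum.inl (Function.update c b a j)) ⬝ᵥ u (Sum.inr j) =
            ∏ j ∈ t, u (Sum.inl (c j)) ⬝ᵥ u (Sum.inr j) :=
          Finset.prod_congr rfl fun j hj => by rw [hcu j hj]
        rw [Finset.prod_insert hb, Function.update_self, hfg, this]
        ring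
    rcases a with a | a <;> rcases b with b | b
    · rw [hsr, not_or] at ha hb
      refine .inr ⟨t, c, insert a (insert b r), _, hg.insertPair (by simpa using hab) ha.1 hb.1, hc,
        ?_, by simp [hst], by simp [hsr, or_assoc], fun u => by simp only [hfg, mul_assoc]⟩
      intro j hj
      have h1 : c j ≠ a := fun h => ha.2 ⟨j, hj, h⟩
      have h2 : c j ≠ b := fun h => hb.2 ⟨j, hj, h⟩
      simp [h1, h2, hcr j hj]
    · exact .inr (mixed a b ha hb)
    · rw [Finset.insert_comm]
      obtain ⟨t', c', r', g', h1, h2, h3, h4, h5, h6⟩ := mixed b a hb ha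
      exact .inr ⟨t', c', r', g', h1, h2, h3, h4, h5, fun u => by
        rw [← h6, dotProduct_comm]⟩
    · refine .inl ⟨a, b, by simpa using hab, by simp, by simp, fun u => ?_⟩
      simp only [Equiv.swap_apply_left, Equiv.swap_apply_right]
      rw [dotProduct_comm]
      congr 1
      refine hf.congr fun x hx => ?_
      rw [Equiv.swap_apply_of_ne_of_ne (fun h : x = Sum.inr a => ha (h ▸ hx))
        (fun h : x = Sum.inr b => hb (h ▸ hx))]

end Split

section SpecialOrthogonal

variable {m n : ℕ}

/-- Contraction of the last `n` slots with the Levi-Civita tensor: only its components at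
permutations are nonzero, so the sum runs over permutations. -/
def contractLeviCivita (ι : Type) (n : ℕ) :
    ((ι ⊕ Fin n → Fin n → ℝ) → ℝ) →ₗ[ℝ] ((ι → Fin n → ℝ) → ℝ) where
  toFun f u := ∑ σ : Equiv.Perm (Fin n), ((Equiv.Perm.sign σ : ℤ) : ℝ) *
    f (Sum.elim u fun j => Pi.single (σ j) 1)
  map_add' f g := by ext u; simp [mul_add, Finset.sum_add_distrib]
  map_smul' c f := by ext u; simp [Finset.mul_sum, mul_left_comm]

theorem contractLeviCivita_apply {ι : Type} (f : (ι ⊕ Fin n → Fin n → ℝ) → ℝ) (u : ι → Fin n → ℝ) :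
    contractLeviCivita ι n f u = ∑ σ : Equiv.Perm (Fin n), ((Equiv.Perm.sign σ : ℤ) : ℝ) *
      f (Sum.elim u fun j => Pi.single (σ j) 1) := rfl

theorem contractLeviCivita_eq_zero {ι : Type} [DecidableEq ι] {f : (ι ⊕ Fin n → Fin n → ℝ) → ℝ}
    {i j : Fin n} (hij : i ≠ j)
    (hf : ∀ u, f (fun b => u (Equiv.swap (Sum.inr i) (Sum.inr j) b)) = f u) :
    contractLeviCivita ι n f = 0 := by
  ext u
  rw [contractLeviCivita_apply, Pi.zero_apply, ← self_eq_neg]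
  -- composing with the transposition changes the sign of every term
  conv_lhs => rw [← Equiv.sum_comp (Equiv.mulRight (Equiv.swap i j))]
  rw [← Finset.sum_neg_distrib]
  refine Finset.sum_congr rfl fun σ _ => ?_
  have : (Sum.elim u fun k => Pi.single ((σ * Equiv.swap i j) k) (1 : ℝ) : ι ⊕ Fin n → Fin n → ℝ) =
      fun b => (Sum.elim u fun k => Pi.single (σ k) 1 : ι ⊕ Fin n → Fin n → ℝ)
        (Equiv.swap (Sum.inr i) (Sum.inr j) b) := by
    ext b : 1
    rcases b with b | b
    · rw [Equiv.swap_apply_of_ne_of_ne (by simp) (by simp)]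
      simp
    · by_cases h1 : b = i
      · subst h1; simp
      by_cases h2 : b = j
      · subst h2; simp
      rw [Equiv.swap_apply_of_ne_of_ne (by simpa using h1) (by simpa using h2)]
      simp [Equiv.swap_apply_of_ne_of_ne h1 h2]
  rw [Equiv.coe_mulRight, this, hf, Equiv.Perm.sign_mul, Equiv.Perm.sign_swap hij]
  simp

theorem contractLeviCivita_isPairing [NeZero m] {f : (Fin m ⊕ Fin n → Fin n → ℝ) → ℝ}
    (hf : IsPairing Finset.univ f) :
    ∃ T ∈ Submodule.span ℝ (kroneckerLeviCivitaProducts m n),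
      ⇑T = contractLeviCivita (Fin m) n f := by
  obtain ⟨i, j, hij, -, -, h⟩ | ⟨t, c, r, g, hg, hc, hcr, hst, hsr, hfg⟩ := hf.swap_or_split
  · exact ⟨0, zero_mem _, (contractLeviCivita_eq_zero hij h).symm⟩
  obtain rfl : t = Finset.univ := Finset.eq_univ_of_forall fun j => (hst j).1 (Finset.mem_univ _)
  obtain ⟨k, e, he, hr, hge⟩ := hg.exists_legs
  have hbij : Function.Bijective (Sum.elim e c) := by
    refine ⟨he.sumElim (by simpa using hc) fun p j h => ?_, fun a => ?_⟩
    · exact hcr j (Finset.mem_univ j) ((hr _).2 ⟨p, h⟩)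
    · obtain h | ⟨j, -, h⟩ := (hsr a).1 (Finset.mem_univ _)
      · obtain ⟨p, hp⟩ := (hr a).1 h
        exact ⟨Sum.inl p, hp⟩
      · exact ⟨Sum.inr j, h⟩
  refine ⟨_, Submodule.subset_span ⟨k, Equiv.ofBijective _ hbij, rfl⟩, funext fun u => ?_⟩
  have h1 : (tensorMul (kroneckerPower k n) (leviCivita n)).domDomCongr
      (Equiv.ofBijective _ hbij) u =
      (∏ j, u (e (j, 0)) ⬝ᵥ u (e (j, 1))) * Matrix.det (Matrix.of fun j => u (c j)) := rfl
  rw [h1, contractLeviCivita_apply, ← Matrix.det_transpose, Matrix.det_apply', Finset.mul_sum]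
  refine Finset.sum_congr rfl fun σ _ => ?_
  simp [hfg, hge]
  ring

theorem contractLeviCivita_of_mem_kroneckerSpan [NeZero m] {S : Tensor (Fin m ⊕ Fin n) n}
    (hS : S ∈ kroneckerSpan (Fin m ⊕ Fin n) n) :
    ∃ T ∈ Submodule.span ℝ (kroneckerLeviCivitaProducts m n),
      ⇑T = contractLeviCivita (Fin m) n S := by
  have h := coe_mem_pairingSpan hS
  generalize (⇑S : (Fin m ⊕ Fin n → Fin n → ℝ) → ℝ) = f at h
  induction h using Submodule.span_induction with
  | mem f h => exact contractLeviCivita_isPairing h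
  | zero => exact ⟨0, zero_mem _, (map_zero _).symm⟩
  | add f g _ _ hf hg =>
    obtain ⟨S, hS, hS'⟩ := hf
    obtain ⟨T, hT, hT'⟩ := hg
    exact ⟨S + T, add_mem hS hT, by rw [map_add, ← hS', ← hT']; rfl⟩
  | smul c f _ hf =>
    obtain ⟨S, hS, hS'⟩ := hf
    exact ⟨c • S, Submodule.smul_mem _ _ hS, by rw [map_smul, ← hS']; rfl⟩

theorem pullback_leviCivita (Q : Matrix (Fin n) (Fin n) ℝ) :
    pullback Q (leviCivita n) = Q.det • leviCivita n := by
  refine MultilinearMap.ext fun u => ?_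
  change Matrix.det (Matrix.of fun a => Q *ᵥ u a) = Q.det * Matrix.det (Matrix.of u)
  rw [← Matrix.det_transpose Q, mul_comm, ← Matrix.det_mul]
  congr 1
  ext a b
  simp [Matrix.mul_apply, Matrix.mulVec, dotProduct, mul_comm]

/-- A tensor that transforms under `O(n)` by the determinant: its product with the Levi-Civita
tensor is `O(n)`-invariant, and contracting the latter with another Levi-Civita tensor gives `n!`
times the original tensor. -/
theorem mem_span_kroneckerLeviCivitaProducts [NeZero m] {T : Tensor (Fin m) n}
    (hT : ∀ Q ∈ Matrix.orthogonalGroup (Fin n) ℝ, pullback Q T = Q.det • T) :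
    T ∈ Submodule.span ℝ (kroneckerLeviCivitaProducts m n) := by
  have h1 : tensorMul T (leviCivita n) ∈ kroneckerSpan (Fin m ⊕ Fin n) n := by
    refine mem_kroneckerSpan_of_orthogonal fun Q hQ => MultilinearMap.ext fun u => ?_
    have hdet : Q.det * Q.det = 1 := by
      have := congrArg Matrix.det ((Matrix.mem_orthogonalGroup_iff _ _).1 hQ)
      simpa using this
    have e1 := congrArg (fun S : Tensor (Fin m) n => S fun a => u (Sum.inl a)) (hT Q hQ)
    have e2 := congrArg (fun S : Tensor (Fin n) n => S fun a => u (Sum.inr a))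
      (pullback_leviCivita Q)
    simp only [pullback_apply, smul_apply, smul_eq_mul] at e1 e2
    rw [pullback_apply, tensorMul_apply, e1, e2, tensorMul_apply]
    linear_combination (T fun a => u (Sum.inl a)) * (leviCivita n fun a => u (Sum.inr a)) * hdet
  obtain ⟨S, hS, h⟩ := contractLeviCivita_of_mem_kroneckerSpan h1
  have h2 : S = (n.factorial : ℝ) • T := by
    refine MultilinearMap.ext fun u => ?_
    rw [h, contractLeviCivita_apply]
    simp only [tensorMul_apply, Sum.elim_inl, Sum.elim_inr, leviCivita_component_perm]
    have hsign : ∀ σ : Equiv.Perm (Fin n),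
        ((Equiv.Perm.sign σ : ℤ) : ℝ) * (T u * ((Equiv.Perm.sign σ : ℤ) : ℝ)) = T u := by
      intro σ
      have : ((Equiv.Perm.sign σ : ℤ) : ℝ) * ((Equiv.Perm.sign σ : ℤ) : ℝ) = 1 := by
        norm_cast
        simp
      linear_combination T u * this
    simp [hsign, Fintype.card_perm]
  have h3 : T = (n.factorial : ℝ)⁻¹ • S := by
    rw [h2, inv_smul_smul₀ (by positivity)]
  rw [h3]
  exact Submodule.smul_mem _ _ hS

theorem isInvariantUnder_iff {G : Submonoid (Matrix (Fin n) (Fin n) ℝ)} {T : Tensor (Fin m) n} :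
    IsInvariantUnder G T ↔ ∀ Q ∈ G, pullback Q T = T :=
  ⟨fun h Q hQ => MultilinearMap.ext (h Q hQ),
    fun h Q hQ u => congrArg (fun S : Tensor (Fin m) n => S u) (h Q hQ)⟩

/-- With a reflection `R`, an `SO(n)`-invariant tensor is the half sum of `T + T · R`, which is
`O(n)`-invariant, and `T - T · R`, which transforms by the determinant. -/
theorem mem_span_of_specialOrthogonal [NeZero m] [NeZero n] {T : Tensor (Fin m) n}
    (hT : ∀ Q ∈ Matrix.specialOrthogonalGroup (Fin n) ℝ, pullback Q T = T) :
    T ∈ Submodule.span ℝ (kroneckerProducts m n ∪ kroneckerLeviCivitaProducts m n) := by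
  let R : Matrix (Fin n) (Fin n) ℝ := Matrix.diagonal (Function.update 1 0 (-1))
  have hRdet : R.det = -1 := by
    simp [R, Matrix.det_diagonal, Finset.prod_update_of_mem]
  have hRR : R * R = 1 := by
    rw [Matrix.diagonal_mul_diagonal, ← Matrix.diagonal_one]
    congr 1
    ext i
    by_cases hi : i = 0
    · subst hi; simp
    · simp [hi]
  have hR : R ∈ Matrix.orthogonalGroup (Fin n) ℝ := by
    rw [Matrix.mem_orthogonalGroup_iff, Matrix.diagonal_transpose]
    exact hRR
  have hdet : ∀ Q ∈ Matrix.orthogonalGroup (Fin n) ℝ, Q.det = 1 ∨ Q.det = -1 := by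
    intro Q hQ
    have := congrArg Matrix.det ((Matrix.mem_orthogonalGroup_iff _ _).1 hQ)
    exact mul_self_eq_one_iff.1 (by simpa using this)
  have hneg : ∀ Q ∈ Matrix.orthogonalGroup (Fin n) ℝ, Q.det = -1 →
      pullback Q T = pullback R T ∧ pullback Q (pullback R T) = T := by
    intro Q hQ hd
    constructor
    · have : Q = Q * R * R := by rw [mul_assoc, hRR, mul_one]
      rw [this, pullback_mul, hT]
      exact ⟨mul_mem hQ hR, by simp [hd, hRdet]⟩
    · rw [← pullback_mul, hT]
      exact ⟨mul_mem hR hQ, by simp [hd, hRdet]⟩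
  have hpos : ∀ Q ∈ Matrix.orthogonalGroup (Fin n) ℝ, Q.det = 1 →
      pullback Q T = T ∧ pullback Q (pullback R T) = pullback R T := by
    intro Q hQ hd
    refine ⟨hT Q ⟨hQ, hd⟩, ?_⟩
    have h := (hneg (R * Q) (mul_mem hR hQ) (by simp [hd, hRdet])).1
    rwa [pullback_mul] at h
  have hadd : T + pullback R T ∈ Submodule.span ℝ (kroneckerProducts m n) := by
    refine mem_kroneckerSpan_of_orthogonal fun Q hQ => ?_
    change pullback Q T + pullback Q (pullback R T) = _
    obtain h | h := hdet Q hQ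
    · rw [(hpos Q hQ h).1, (hpos Q hQ h).2]
    · rw [(hneg Q hQ h).1, (hneg Q hQ h).2, add_comm]
  have hsub : T - pullback R T ∈ Submodule.span ℝ (kroneckerLeviCivitaProducts m n) := by
    refine mem_span_kroneckerLeviCivitaProducts fun Q hQ => ?_
    change pullback Q T - pullback Q (pullback R T) = _
    obtain h | h := hdet Q hQ
    · rw [(hpos Q hQ h).1, (hpos Q hQ h).2, h, one_smul]
    · rw [(hneg Q hQ h).1, (hneg Q hQ h).2, h]
      module
  have hT2 : T = (1 / 2 : ℝ) • ((T + pullback R T) + (T - pullback R T)) := by module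
  rw [hT2, Submodule.span_union]
  exact Submodule.smul_mem _ _ (Submodule.add_mem_sup hadd hsub)

end SpecialOrthogonal

end IsotropicTensor

theorem mainTheorem1 (m n : ℕ) (T : IsotropicTensor.Tensor (Fin m) n) :
    (IsotropicTensor.IsInvariantUnder (Matrix.specialOrthogonalGroup (Fin n) ℝ) T →
      T ∈ Submodule.span ℝ (IsotropicTensor.kroneckerProducts m n ∪
        IsotropicTensor.kroneckerLeviCivitaProducts m n)) ∧
    (IsotropicTensor.IsInvariantUnder (Matrix.orthogonalGroup (Fin n) ℝ) T →
      T ∈ Submodule.span ℝ (IsotropicTensor.kroneckerProducts m n)) := by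
  have hO : IsotropicTensor.IsInvariantUnder (Matrix.orthogonalGroup (Fin n) ℝ) T →
      T ∈ Submodule.span ℝ (IsotropicTensor.kroneckerProducts m n) := fun h =>
    IsotropicTensor.mem_kroneckerSpan_of_orthogonal (IsotropicTensor.isInvariantUnder_iff.1 h)
  refine ⟨fun h => ?_, hO⟩
  -- without slots, or in dimension zero, every tensor is invariant under all matrices
  obtain rfl | hm := eq_or_ne m 0
  · exact Submodule.span_mono Set.subset_union_left
      (hO fun Q _ u => congrArg T (Subsingleton.elim _ _))
  obtain rfl | hn := eq_or_ne n 0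
  · exact Submodule.span_mono Set.subset_union_left
      (hO fun Q _ u => congrArg T (Subsingleton.elim _ _))
  have : NeZero m := ⟨hm⟩
  have : NeZero n := ⟨hn⟩
  exact IsotropicTensor.mem_span_of_specialOrthogonal (IsotropicTensor.isInvariantUnder_iff.1 h)
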